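/- Let $X$ be a CAT(0) space. For a unit-speed geodesic $\alpha:I\to X$ defined on a closed interval $I\subseteq\mathbb R$ and a number $r$ with $[r-\frac12,r+\frac12]\subseteq \operatorname{int} I$, let $\pi_\alpha:X\to I$ be the closest-point projection to $\alpha$. The curtain dual to $\alpha$ at $r$ is $h=\pi_\alpha^{-1}([r-\frac12,r+\frac12])$, with half spaces $h^-=\pi_\alpha^{-1}((-\infty,r-\frac12))$ and $h^+=\pi_\alpha^{-1}((r+\frac12,\infty))$; $h$ separates $A$ from $B$ if $A\subseteq h^-$ and $B\subseteq h^+$, or vice versa. A chain is a sequence $(h_i)$ of pairwise disjoint curtains such that $h_i$ separates $h_{i-1}$ from $h_{i+1}$ for all $i$. Disjoint curtains $h,h'$ are $L$-separated if every chain all of whose members meet both $h$ and $h'$ has cardinality at most $L$, and an $L$-chain is a chain whose members are pairwise $L$-separated. Put $d_L(x,x)=0$ and, for $x\ne y$, let $d_L(x,y)$ be $1$ plus the maximal cardinality of an $L$-chain every member of which separates $x$ from $y$. Fix $\lambda_L\in(0,1)$, $L\ge 1$, with $\sum_{L\ge1}\lambda_L=1$ and $\sum_{L\ge1}L^2\lambda_L<\infty$.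 The curtain model of $X$ is $X_D=(X,D)$, where $D(x,y)=\sum_{L\ge1}\lambda_L d_L(x,y)$. (1) Let $X$ be a CAT(0) space and let $Z\subseteq X$ be a closed convex subset which, with the induced metric, is isometric to the $\ell^2$-product $Y_1\times Y_2$ of two unbounded metric spaces $Y_1$ and $Y_2$. Then $Z$ is bounded in $X_D$, that is, $\sup_{x,y\in Z}D(x,y)<\infty$. (2) Let $X$ and $Y$ be unbounded CAT(0) spaces. Then the $\ell^2$-product $X\times Y$ is a CAT(0) space, and its curtain model $(X\times Y)_D$ is bounded. -/

import Mathlib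

open scoped ENNReal NNReal

/-- `γ`, restricted to `[0, 1]`, is a geodesic segment from `x` to `y`, parametrised
proportionally to arc length. -/
structure IsGeodSegment {X : Type*} [MetricSpace X] (γ : ℝ → X) (x y : X) : Prop where
  source : γ 0 = x
  target : γ 1 = y
  dist_eq : ∀ s ∈ Set.Icc (0 : ℝ) 1, ∀ t ∈ Set.Icc (0 : ℝ) 1,
    dist (γ s) (γ t) = |s - t| * dist x y

/-- CAT(0) spaces: geodesic metric spaces all of whose geodesic triangles are at least as thin
as their Euclidean comparison triangles. Two points on distinct sides of a triangle lie on two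
sides issuing from a common vertex, which is called `x` here; `γ` and `η` are those sides, and
`x' y' z'` is a comparison triangle in the Euclidean plane. -/
structure IsCAT0 (X : Type*) [MetricSpace X] : Prop where
  geodesic : ∀ x y : X, ∃ γ : ℝ → X, IsGeodSegment γ x y
  thin : ∀ (x y z : X) (γ η : ℝ → X), IsGeodSegment γ x y → IsGeodSegment η x z →
    ∀ x' y' z' : EuclideanSpace ℝ (Fin 2),
      dist x' y' = dist x y → dist x' z' = dist x z → dist y' z' = dist y z →
      ∀ s ∈ Set.Icc (0 : ℝ) 1, ∀ t ∈ Set.Icc (0 : ℝ) 1,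
        dist (γ s) (η t) ≤ dist (AffineMap.lineMap x' y' s) (AffineMap.lineMap x' z' t)

/-- A subset of a geodesic space is convex if it contains every geodesic segment joining two of
its points. -/
def IsGeodConvex {X : Type*} [MetricSpace X] (S : Set X) : Prop :=
  ∀ x ∈ S, ∀ y ∈ S, ∀ γ : ℝ → X, IsGeodSegment γ x y → ∀ t ∈ Set.Icc (0 : ℝ) 1, γ t ∈ S

/-- The data of a curtain: a unit speed geodesic `α : I → X` on a closed interval `I` (bounded
or not), given by a function on `ℝ` of which only the restriction to `I` is used, and a number
`r` such that `[r - 1/2, r + 1/2]` lies in the interior of `I`. -/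
structure Curtain (X : Type*) [MetricSpace X] where
  I : Set ℝ
  isClosed_I : IsClosed I
  ordConnected_I : I.OrdConnected
  α : ℝ → X
  isometry_α : ∀ s ∈ I, ∀ t ∈ I, dist (α s) (α t) = |s - t|
  r : ℝ
  pole_subset : Set.Icc (r - 1 / 2) (r + 1 / 2) ⊆ interior I

namespace Curtain

variable {X : Type*} [MetricSpace X]

/-- `α t` is a closest point to `x` on the geodesic `α`. In a CAT(0) space, exactly one `t ∈ I`
has this property, so that this is the graph of the closest point projection `π_α`, seen as a
map to `I`. -/
def ProjectsTo (h : Curtain X) (x : X) (t : ℝ) : Prop :=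
  t ∈ h.I ∧ ∀ s ∈ h.I, dist x (h.α t) ≤ dist x (h.α s)

/-- The curtain as a subset of the space: the preimage of its pole under the projection. -/
def carrier (h : Curtain X) : Set X :=
  {x | ∃ t ∈ Set.Icc (h.r - 1 / 2) (h.r + 1 / 2), h.ProjectsTo x t}

/-- The half space `h⁻`. -/
def neg (h : Curtain X) : Set X :=
  {x | ∃ t ∈ Set.Iio (h.r - 1 / 2), h.ProjectsTo x t}

/-- The half space `h⁺`. -/
def pos (h : Curtain X) : Set X :=
  {x | ∃ t ∈ Set.Ioi (h.r + 1 / 2), h.ProjectsTo x t}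

/-- The curtain `h` separates the sets `A` and `B`. -/
def Separates (h : Curtain X) (A B : Set X) : Prop :=
  (A ⊆ h.neg ∧ B ⊆ h.pos) ∨ (A ⊆ h.pos ∧ B ⊆ h.neg)

/-- A (finite) chain of `n` curtains: pairwise disjoint curtains `h_0, …, h_{n-1}` such that
`h_i` separates `h_{i-1}` from `h_{i+1}`. -/
def IsChain {n : ℕ} (c : Fin n → Curtain X) : Prop :=
  (∀ i j, i ≠ j → Disjoint (c i).carrier (c j).carrier) ∧
  ∀ i j k : Fin n, (i : ℕ) + 1 = j → (j : ℕ) + 1 = k →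
    (c j).Separates (c i).carrier (c k).carrier

/-- Disjoint curtains `h` and `k` are `L`-separated if every chain all of whose members meet
both `h` and `k` has cardinality at most `L`. (A consecutive part of a chain is a chain, so it
is enough to consider finite chains.) -/
def LSeparated (L : ℕ) (h k : Curtain X) : Prop :=
  Disjoint h.carrier k.carrier ∧
  ∀ (n : ℕ) (c : Fin n → Curtain X), IsChain c →
    (∀ i, ((c i).carrier ∩ h.carrier).Nonempty ∧ ((c i).carrier ∩ k.carrier).Nonempty) → n ≤ L

/-- An `L`-chain: a chain whose members are pairwise `L`-separated. -/
def IsLChain (L : ℕ) {n : ℕ} (c : Fin n → Curtain X) : Prop :=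
  IsChain c ∧ ∀ i j, i ≠ j → LSeparated L (c i) (c j)

end Curtain

open Classical in
/-- The `L`-metric `d_L`: `d_L(x, x) = 0`, and `d_L(x, y)` is one more than the largest
cardinality of an `L`-chain separating `x` from `y` if `x ≠ y`. It is given values in `ℕ∞` so
that no junk value can occur. -/
noncomputable def curtainDistL {X : Type*} [MetricSpace X] (L : ℕ) (x y : X) : ℕ∞ :=
  if x = y then 0 else
    1 + sSup {m : ℕ∞ | ∃ (n : ℕ) (c : Fin n → Curtain X), m = n ∧ Curtain.IsLChain L c ∧
      ∀ i, (c i).Separates {x} {y}}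

/-- The weight sequences `(λ_L)_{L ≥ 1}` allowed in the construction of the curtain model. -/
structure IsCurtainWeight (lam : ℕ+ → ℝ) : Prop where
  mem_Ioo : ∀ L, lam L ∈ Set.Ioo (0 : ℝ) 1
  hasSum_one : HasSum lam 1
  summable_sq : Summable fun L : ℕ+ => ((L : ℕ) : ℝ) ^ 2 * lam L

/-- The metric `D = ∑_{L ≥ 1} λ_L d_L` of the curtain model, with values in `[0, ∞]`. -/
noncomputable def curtainDist {X : Type*} [MetricSpace X] (lam : ℕ+ → ℝ) (x y : X) : ℝ≥0∞ :=
  ∑' L : ℕ+, ENNReal.ofReal (lam L) * (curtainDistL (L : ℕ) x y : ℝ≥0∞)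

/-- The set `S` has finite diameter in the curtain model `X_D = (X, D)`. -/
def IsBoundedInCurtainModel {X : Type*} [MetricSpace X] (lam : ℕ+ → ℝ) (S : Set X) : Prop :=
  ∃ C : ℝ≥0, ∀ x ∈ S, ∀ y ∈ S, curtainDist lam x y ≤ (C : ℝ≥0∞)

/-!
A product of two unbounded geodesic spaces contains long flat strips, and a flat strip leaves no
room for a long `L`-chain. Let `Y₁ × Y₂` be isometrically embedded in the CAT(0) space `X`, and
let curtains `h₁, …, hₙ` of `X` that are pairwise `L`-separated all separate `(x₁, x₂)` from
`(y₁, x₂)`. Since `Y₂` is geodesic and unbounded, there is a vertical unit speed geodesic of length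
at least `2L + 2` starting at `(x₁, x₂)`. The `L + 1` curtains dual to it at heights
`1, 3, …, 2L + 1` form a chain, and each contains the horizontal segment over `[x₁, y₁]` at its
height. By `L`-separation at most one `hⱼ` meets all of these segments. If `hⱼ` misses the segment
at height `t`, then both ends of the segment lie on the same side of `hⱼ`, so `hⱼ` separates the
ends of one of the two vertical segments of length `t` below them. As curtains have width at least
`1` (`Curtain.card_le_of_separates`), each of these is crossed by at most `t` of the disjoint
curtains `hⱼ`. Summing over the heights gives `n ≤ 2 (L + 1)² + 1`
(`card_le_of_separates_of_snd_eq`).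

Two arbitrary points of the product are joined through a corner
(`card_le_of_separates_of_prod`), so `d_L ≤ 20 L²` on the product. Since `∑ L² λ_L` converges, `D`
is bounded there.

The width of curtains rests on the fact that closest point projections to geodesics are
`1`-Lipschitz, which follows from the Bruhat–Tits inequality and the four point inequality for
quadrilaterals. That the `ℓ²`-product of CAT(0) spaces is CAT(0) (`IsCAT0.prod`) holds because the
components of a geodesic are geodesics and the comparison distance is, when squared, affine in the
squared side lengths.
-/

/-! ### Comparison triangles and the metric inequalities of CAT(0) spaces -/

/-- The distance between points on two sides of a Euclidean triangle is, when squared, an affine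
function of the squared side lengths. This is why the CAT(0) inequality passes to
`ℓ²`-products. -/
lemma dist_sq_lineMap_lineMap {V : Type*} [NormedAddCommGroup V] [InnerProductSpace ℝ V]
    (x y z : V) (s t : ℝ) :
    dist (AffineMap.lineMap x y s) (AffineMap.lineMap x z t) ^ 2 =
      s ^ 2 * dist x y ^ 2 + t ^ 2 * dist x z ^ 2
        - s * t * (dist x y ^ 2 + dist x z ^ 2 - dist y z ^ 2) := by
  have h1 : (AffineMap.lineMap x y s : V) - AffineMap.lineMap x z t
      = s • (y - x) - t • (z - x) := by
    simp [AffineMap.lineMap_apply]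
  have h2 : y - z = (y - x) - (z - x) := by abel
  rw [dist_eq_norm, h1, dist_comm x y, dist_comm x z, dist_eq_norm y x, dist_eq_norm z x,
    dist_eq_norm y z, h2, norm_sub_sq_real, norm_sub_sq_real (y - x), norm_smul, norm_smul,
    real_inner_smul_left, real_inner_smul_right, mul_pow, mul_pow, Real.norm_eq_abs,
    Real.norm_eq_abs, sq_abs, sq_abs]
  ring

lemma exists_euclidean_triangle {a b c : ℝ} (ha : 0 ≤ a) (hb : 0 ≤ b) (hc : 0 ≤ c)
    (habc : a ≤ b + c) (hbac : b ≤ a + c) (hcab : c ≤ a + b) :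
    ∃ x y z : EuclideanSpace ℝ (Fin 2), dist x y = a ∧ dist x z = b ∧ dist y z = c := by
  rcases ha.eq_or_lt with rfl | ha
  · have : c = b := by linarith
    subst this
    refine ⟨!₂[0, 0], !₂[0, 0], !₂[c, 0], ?_, ?_, ?_⟩ <;>
      simp [EuclideanSpace.dist_eq, Fin.sum_univ_two, Real.dist_eq, Real.sqrt_sq, hc]
  · -- The third vertex has first coordinate `u` by the law of cosines.
    set u : ℝ := (a ^ 2 + b ^ 2 - c ^ 2) / (2 * a) with hu
    have hua : 2 * a * u = a ^ 2 + b ^ 2 - c ^ 2 := by rw [hu]; field_simp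
    have hub : u ^ 2 ≤ b ^ 2 := by
      apply sq_le_sq'
      · nlinarith
      · nlinarith
    have hv := Real.sq_sqrt (sub_nonneg.2 hub)
    refine ⟨!₂[0, 0], !₂[a, 0], !₂[u, √(b ^ 2 - u ^ 2)], ?_, ?_, ?_⟩
    · simp [EuclideanSpace.dist_eq, Fin.sum_univ_two, Real.dist_eq, Real.sqrt_sq, ha.le]
    · simp only [EuclideanSpace.dist_eq, Fin.sum_univ_two, Real.dist_eq, sq_abs]
      rw [Real.sqrt_eq_iff_mul_self_eq (by positivity) hb]
      simp only [Matrix.cons_val_zero, Matrix.cons_val_one]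
      nlinarith
    · simp only [EuclideanSpace.dist_eq, Fin.sum_univ_two, Real.dist_eq, sq_abs]
      rw [Real.sqrt_eq_iff_mul_self_eq (by positivity) hc]
      simp only [Matrix.cons_val_zero, Matrix.cons_val_one]
      nlinarith

namespace IsCAT0

variable {X : Type*} [MetricSpace X]

lemma dist_sq_le (hX : IsCAT0 X) {x y z : X} {γ η : ℝ → X}
    (hγ : IsGeodSegment γ x y) (hη : IsGeodSegment η x z) {s t : ℝ}
    (hs : s ∈ Set.Icc (0 : ℝ) 1) (ht : t ∈ Set.Icc (0 : ℝ) 1) :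
    dist (γ s) (η t) ^ 2 ≤ s ^ 2 * dist x y ^ 2 + t ^ 2 * dist x z ^ 2
      - s * t * (dist x y ^ 2 + dist x z ^ 2 - dist y z ^ 2) := by
  obtain ⟨x', y', z', h1, h2, h3⟩ := exists_euclidean_triangle
    (dist_nonneg (x := x) (y := y)) (dist_nonneg (x := x) (y := z))
    (dist_nonneg (x := y) (y := z))
    (by linarith [dist_triangle x z y, dist_comm y z]) (dist_triangle x y z)
    (by linarith [dist_triangle y x z, dist_comm y x])
  rw [← h1, ← h2, ← h3, ← dist_sq_lineMap_lineMap]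
  exact pow_le_pow_left₀ dist_nonneg (hX.thin x y z γ η hγ hη x' y' z' h1 h2 h3 s hs t ht) 2

/-- The inequality of Bruhat and Tits: squared distance functions are `2`-convex along
geodesics. -/
lemma dist_sq_segment_le (hX : IsCAT0 X) {x y : X} {γ : ℝ → X} (hγ : IsGeodSegment γ x y)
    (z : X) {s : ℝ} (hs : s ∈ Set.Icc (0 : ℝ) 1) :
    dist z (γ s) ^ 2 ≤ (1 - s) * dist z x ^ 2 + s * dist z y ^ 2
      - s * (1 - s) * dist x y ^ 2 := by
  obtain ⟨η, hη⟩ := hX.geodesic x z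
  have h := hX.dist_sq_le hγ hη hs (Set.right_mem_Icc.2 zero_le_one)
  rw [hη.target] at h
  rw [dist_comm z, dist_comm z, dist_comm z]
  linarith

/-- The four point inequality for quadrilaterals with diagonals `ac` and `bd`. -/
lemma dist_sq_diagonals_le (hX : IsCAT0 X) (a b c d : X) :
    dist a c ^ 2 + dist b d ^ 2 ≤
      dist a b ^ 2 + dist b c ^ 2 + dist c d ^ 2 + dist d a ^ 2 := by
  obtain ⟨γ, hγ⟩ := hX.geodesic a c
  have hs : (1 / 2 : ℝ) ∈ Set.Icc (0 : ℝ) 1 := by constructor <;> norm_num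
  have hb := hX.dist_sq_segment_le hγ b hs
  have hd := hX.dist_sq_segment_le hγ d hs
  have htri := dist_triangle_right b d (γ (1 / 2))
  have hsq := pow_le_pow_left₀ dist_nonneg htri 2
  rw [dist_comm b a] at hb
  rw [dist_comm d c] at hd
  nlinarith [sq_nonneg (dist b (γ (1 / 2)) - dist d (γ (1 / 2)))]

/-- The angle at a closest point on a geodesic segment is at least `π / 2`. -/
lemma pythagoras_of_closest (hX : IsCAT0 X) {p q : X} {γ : ℝ → X} (hγ : IsGeodSegment γ p q)
    {x : X} (hp : ∀ s ∈ Set.Icc (0 : ℝ) 1, dist x p ≤ dist x (γ s)) :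
    dist x p ^ 2 + dist p q ^ 2 ≤ dist x q ^ 2 := by
  have key : ∀ s ∈ Set.Ioc (0 : ℝ) 1,
      dist x p ^ 2 + dist p q ^ 2 - dist x q ^ 2 ≤ s * dist p q ^ 2 := by
    intro s hs
    have h1 := hX.dist_sq_segment_le hγ x (Set.Ioc_subset_Icc_self hs)
    have h2 := pow_le_pow_left₀ dist_nonneg (hp s (Set.Ioc_subset_Icc_self hs)) 2
    have h3 : s * (dist x p ^ 2 + dist p q ^ 2 - dist x q ^ 2) ≤ s * (s * dist p q ^ 2) := by
      nlinarith
    exact le_of_mul_le_mul_left h3 hs.1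
  have hlim : Filter.Tendsto (fun s : ℝ => s * dist p q ^ 2) (nhdsWithin 0 (Set.Ioi 0))
      (nhds (0 * dist p q ^ 2)) :=
    ((continuous_id.mul continuous_const).tendsto 0).mono_left nhdsWithin_le_nhds
  have := ge_of_tendsto hlim
    (Filter.eventually_of_mem (Ioc_mem_nhdsGT (zero_lt_one' ℝ)) key)
  linarith

end IsCAT0

/-! ### Closest point projections to the geodesics of curtains -/

namespace Curtain

variable {X : Type*} [MetricSpace X] (h : Curtain X)

lemma continuousOn_α : ContinuousOn h.α h.I := by
  refine (LipschitzOnWith.of_dist_le_mul (K := 1) fun s hs t ht => ?_).continuousOn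
  rw [h.isometry_α s hs t ht, Real.dist_eq, NNReal.coe_one, one_mul]

lemma r_mem_I : h.r ∈ h.I :=
  interior_subset (h.pole_subset ⟨by linarith, by linarith⟩)

lemma exists_projectsTo (x : X) : ∃ t, h.ProjectsTo x t := by
  have hev : ∀ᶠ s in Filter.cocompact ℝ ⊓ Filter.principal h.I,
      dist x (h.α h.r) ≤ dist x (h.α s) := by
    rw [Filter.eventually_inf_principal]
    have : Filter.Tendsto (fun s : ℝ => dist s h.r) (Filter.cocompact ℝ) Filter.atTop :=
      tendsto_dist_right_cocompact_atTop h.r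
    filter_upwards [this.eventually_ge_atTop (2 * dist x (h.α h.r))] with s hs hsI
    have h1 := h.isometry_α s hsI h.r h.r_mem_I
    rw [← Real.dist_eq] at h1
    have h2 := dist_triangle_left (h.α s) (h.α h.r) x
    linarith
  obtain ⟨t, ht, hmin⟩ := ContinuousOn.exists_isMinOn' (f := fun s => dist x (h.α s))
    ((continuous_const.dist continuous_id).comp_continuousOn h.continuousOn_α) h.isClosed_I h.r_mem_I hev
  exact ⟨t, ht, fun s hs => hmin hs⟩

/-- The parameter of a closest point to `x` on the geodesic to which the curtain `h` is dual.
In a CAT(0) space this is the closest point projection to the geodesic, as a map to `h.I`. -/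
noncomputable def proj (x : X) : ℝ := Classical.choose (h.exists_projectsTo x)

lemma projectsTo_proj (x : X) : h.ProjectsTo x (h.proj x) :=
  Classical.choose_spec (h.exists_projectsTo x)

variable {h}

lemma isGeodSegment_α {s t : ℝ} (hs : s ∈ h.I) (ht : t ∈ h.I) :
    IsGeodSegment (fun u => h.α (AffineMap.lineMap s t u)) (h.α s) (h.α t) ∧
      ∀ u ∈ Set.Icc (0 : ℝ) 1, AffineMap.lineMap s t u ∈ h.I := by
  have hmem : ∀ u ∈ Set.Icc (0 : ℝ) 1, AffineMap.lineMap s t u ∈ h.I := fun u hu =>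
    h.ordConnected_I.convex.segment_subset hs ht
      (segment_eq_image_lineMap ℝ s t ▸ Set.mem_image_of_mem _ hu)
  refine ⟨⟨by simp, by simp, fun u hu v hv => ?_⟩, hmem⟩
  rw [h.isometry_α _ (hmem u hu) _ (hmem v hv), h.isometry_α s hs t ht,
    AffineMap.lineMap_apply_ring', AffineMap.lineMap_apply_ring', ← abs_mul, ← abs_neg]
  ring_nf

lemma ProjectsTo.pythagoras (hX : IsCAT0 X) {x : X} {s t : ℝ} (hs : h.ProjectsTo x s)
    (ht : t ∈ h.I) : dist x (h.α s) ^ 2 + (s - t) ^ 2 ≤ dist x (h.α t) ^ 2 := by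
  obtain ⟨hγ, hmem⟩ := isGeodSegment_α hs.1 ht
  have := hX.pythagoras_of_closest hγ (x := x) fun u hu => hs.2 _ (hmem u hu)
  rwa [h.isometry_α s hs.1 t ht, sq_abs] at this

/-- Closest point projections to geodesics in CAT(0) spaces are `1`-Lipschitz. -/
lemma ProjectsTo.dist_le (hX : IsCAT0 X) {x y : X} {s t : ℝ} (hs : h.ProjectsTo x s)
    (ht : h.ProjectsTo y t) : |s - t| ≤ dist x y := by
  have h1 := hs.pythagoras hX ht.1
  have h2 := ht.pythagoras hX hs.1
  have h3 := hX.dist_sq_diagonals_le x (h.α s) (h.α t) y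
  rw [h.isometry_α s hs.1 t ht.1, sq_abs, dist_comm (h.α t) y, dist_comm (h.α s) y,
    dist_comm y x] at h3
  refine abs_le_of_sq_le_sq ?_ dist_nonneg
  nlinarith

lemma projectsTo_iff (hX : IsCAT0 X) {x : X} {t : ℝ} : h.ProjectsTo x t ↔ h.proj x = t := by
  constructor
  · intro ht
    have := (h.projectsTo_proj x).dist_le hX ht
    rw [dist_self] at this
    exact sub_eq_zero.1 (abs_nonpos_iff.1 this)
  · rintro rfl
    exact h.projectsTo_proj x

lemma lipschitzWith_proj (hX : IsCAT0 X) : LipschitzWith 1 h.proj :=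
  LipschitzWith.of_dist_le_mul fun x y => by
    simpa [Real.dist_eq] using (h.projectsTo_proj x).dist_le hX (h.projectsTo_proj y)

lemma mem_carrier_iff (hX : IsCAT0 X) {x : X} :
    x ∈ h.carrier ↔ h.proj x ∈ Set.Icc (h.r - 1 / 2) (h.r + 1 / 2) := by
  simp [carrier, projectsTo_iff hX]

lemma mem_neg_iff (hX : IsCAT0 X) {x : X} : x ∈ h.neg ↔ h.proj x < h.r - 1 / 2 := by
  simp [neg, projectsTo_iff hX]

lemma mem_pos_iff (hX : IsCAT0 X) {x : X} : x ∈ h.pos ↔ h.r + 1 / 2 < h.proj x := by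
  simp [pos, projectsTo_iff hX]

lemma separates_singleton_iff (hX : IsCAT0 X) {x y : X} :
    h.Separates {x} {y} ↔
      (h.proj x < h.r - 1 / 2 ∧ h.r + 1 / 2 < h.proj y) ∨
      (h.r + 1 / 2 < h.proj x ∧ h.proj y < h.r - 1 / 2) := by
  simp only [Separates, Set.singleton_subset_iff, mem_neg_iff hX, mem_pos_iff hX]

/-- A point not in `h` lies in one of the two half spaces of `h`, so `h` separates it from the one
of `x` and `y` in the other half space. -/
lemma Separates.trichotomy (hX : IsCAT0 X) {x y : X} (hs : h.Separates {x} {y}) (z : X) :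
    z ∈ h.carrier ∨ h.Separates {x} {z} ∨ h.Separates {z} {y} := by
  rw [separates_singleton_iff hX] at *
  rw [separates_singleton_iff hX, mem_carrier_iff hX, Set.mem_Icc]
  rcases lt_or_ge (h.proj z) (h.r - 1 / 2) with h1 | h1 <;>
  rcases lt_or_ge (h.r + 1 / 2) (h.proj z) with h2 | h2 <;> tauto

end Curtain

lemma IsGeodSegment.continuousOn {X : Type*} [MetricSpace X] {γ : ℝ → X} {x y : X}
    (hγ : IsGeodSegment γ x y) : ContinuousOn γ (Set.Icc 0 1) := by
  refine (LipschitzOnWith.of_dist_le_mul (K := nndist x y) fun s hs t ht => ?_).continuousOn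
  rw [hγ.dist_eq s hs t ht, Real.dist_eq, mul_comm, coe_nndist]

namespace Curtain

variable {X : Type*} [MetricSpace X]

/-- A geodesic joining two points which `h` separates passes through the middle of `h`. -/
lemma Separates.exists_proj_eq (hX : IsCAT0 X) {h : Curtain X} {x y : X}
    (hs : h.Separates {x} {y}) {γ : ℝ → X} (hγ : IsGeodSegment γ x y) :
    ∃ u ∈ Set.Icc (0 : ℝ) 1, h.proj (γ u) = h.r := by
  have hc : ContinuousOn (fun u => h.proj (γ u)) (Set.Icc 0 1) :=
    (lipschitzWith_proj hX).continuous.comp_continuousOn hγ.continuousOn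
  rw [separates_singleton_iff hX, ← hγ.source, ← hγ.target] at hs
  rcases hs with hs | hs
  · exact intermediate_value_Icc zero_le_one hc ⟨by linarith, by linarith⟩
  · exact intermediate_value_Icc' zero_le_one hc ⟨by linarith, by linarith⟩

/-- Curtains have width at least `1`: a geodesic of length at most `d` crosses at most `d`
pairwise disjoint curtains. -/
lemma card_le_of_separates (hX : IsCAT0 X) {ι : Type*} {S : Finset ι} {c : ι → Curtain X}
    (hdisj : ∀ i ∈ S, ∀ j ∈ S, i ≠ j → Disjoint (c i).carrier (c j).carrier)
    {x y : X} {d : ℕ} (hd : dist x y ≤ d) (hsep : ∀ i ∈ S, (c i).Separates {x} {y}) :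
    S.card ≤ d := by
  obtain ⟨γ, hγ⟩ := hX.geodesic x y
  have hlip : ∀ i, ∀ u ∈ Set.Icc (0 : ℝ) 1, ∀ v ∈ Set.Icc (0 : ℝ) 1,
      |(c i).proj (γ u) - (c i).proj (γ v)| ≤ |u * dist x y - v * dist x y| := by
    intro i u hu v hv
    have := (lipschitzWith_proj (h := c i) hX).dist_le_mul (γ u) (γ v)
    rw [← sub_mul, abs_mul, abs_of_nonneg (dist_nonneg (x := x) (y := y))]
    rwa [NNReal.coe_one, one_mul, hγ.dist_eq u hu v hv, Real.dist_eq] at this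
  have hex : ∀ i, ∃ u : ℝ, i ∈ S → u ∈ Set.Icc (0 : ℝ) 1 ∧ (c i).proj (γ u) = (c i).r := by
    intro i
    by_cases hi : i ∈ S
    · obtain ⟨u, hu⟩ := (hsep i hi).exists_proj_eq hX hγ
      exact ⟨u, fun _ => hu⟩
    · exact ⟨0, fun h => absurd h hi⟩
  choose u hu using hex
  rw [← Finset.card_range d]
  -- The crossing points of two of the curtains are at distance at least `1`, since otherwise
  -- the point halfway between them lies in both curtains. So they have distinct integer parts.
  refine Finset.card_le_card_of_injOn (fun i => ⌊u i * dist x y⌋₊) ?_ ?_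
  · intro i hi
    obtain ⟨hui, hri⟩ := hu i hi
    have h1 := hlip i 1 (Set.right_mem_Icc.2 zero_le_one) (u i) hui
    have hs := (separates_singleton_iff hX).1 (hsep i hi)
    rw [hri, hγ.target] at h1
    have h2 : u i * dist x y ≤ dist x y := mul_le_of_le_one_left dist_nonneg hui.2
    have h3 : u i * dist x y < dist x y := by
      rw [one_mul, abs_of_nonneg (by linarith : 0 ≤ dist x y - u i * dist x y)] at h1
      rcases hs with hs | hs
      · linarith [le_abs_self ((c i).proj y - (c i).r)]
      · linarith [neg_abs_le ((c i).proj y - (c i).r)]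
    simp only [Finset.coe_range, Set.mem_Iio]
    rw [Nat.floor_lt (mul_nonneg hui.1 dist_nonneg)]
    linarith
  · intro i hi j hj hij
    by_contra hne
    obtain ⟨hui, hri⟩ := hu i hi
    obtain ⟨huj, hrj⟩ := hu j hj
    have hlt : |u i * dist x y - u j * dist x y| < 1 := by
      have hij' : ⌊u i * dist x y⌋₊ = ⌊u j * dist x y⌋₊ := hij
      have hi1 := Nat.floor_le (mul_nonneg hui.1 (dist_nonneg (x := x) (y := y)))
      have hj1 := Nat.floor_le (mul_nonneg huj.1 (dist_nonneg (x := x) (y := y)))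
      have hi2 := Nat.lt_floor_add_one (u i * dist x y)
      have hj2 := Nat.lt_floor_add_one (u j * dist x y)
      rw [hij'] at hi1 hi2
      exact abs_lt.2 ⟨by linarith, by linarith⟩
    have hm : (u i + u j) / 2 ∈ Set.Icc (0 : ℝ) 1 :=
      ⟨by linarith [hui.1, huj.1], by linarith [hui.2, huj.2]⟩
    have hi' := abs_le.1 (hlip i _ hm (u i) hui)
    have hj' := abs_le.1 (hlip j _ hm (u j) huj)
    rw [hri, show (u i + u j) / 2 * dist x y - u i * dist x y
      = -((u i * dist x y - u j * dist x y) / 2) by ring, abs_neg, abs_div, abs_two] at hi'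
    rw [hrj, show (u i + u j) / 2 * dist x y - u j * dist x y
      = (u i * dist x y - u j * dist x y) / 2 by ring, abs_div, abs_two] at hj'
    have hmi : γ ((u i + u j) / 2) ∈ (c i).carrier := by
      rw [mem_carrier_iff hX]
      constructor <;> linarith [hi'.1, hi'.2]
    have hmj : γ ((u i + u j) / 2) ∈ (c j).carrier := by
      rw [mem_carrier_iff hX]
      constructor <;> linarith [hj'.1, hj'.2]
    exact Set.disjoint_left.1 (hdisj i hi j hj hne) hmi hmj

end Curtain

/-! ### Geodesics in `ℓ²`-products -/

lemma WithLp.prod_dist_sq_eq {Y₁ Y₂ : Type*} [MetricSpace Y₁] [MetricSpace Y₂]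
    (p q : WithLp 2 (Y₁ × Y₂)) :
    dist p q ^ 2 = dist p.fst q.fst ^ 2 + dist p.snd q.snd ^ 2 := by
  rw [WithLp.prod_dist_eq_add (by norm_num), ← Real.rpow_natCast, ← Real.rpow_mul (by positivity)]
  norm_num

lemma WithLp.dist_toLp_same_fst {Y₁ Y₂ : Type*} [MetricSpace Y₁] [MetricSpace Y₂]
    (a : Y₁) (b c : Y₂) :
    dist (WithLp.toLp 2 (a, b)) (WithLp.toLp 2 (a, c)) = dist b c := by
  have := WithLp.prod_dist_sq_eq (WithLp.toLp 2 (a, b)) (WithLp.toLp 2 (a, c))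
  simp only [WithLp.toLp_fst, WithLp.toLp_snd, dist_self] at this
  exact (pow_left_inj₀ dist_nonneg dist_nonneg two_ne_zero).1 (by linarith)

lemma eq_and_eq_of_le_of_sq_add_sq_le {u₁ u₂ v₁ v₂ : ℝ} (hu₁ : 0 ≤ u₁) (hu₂ : 0 ≤ u₂)
    (h₁ : u₁ ≤ v₁) (h₂ : u₂ ≤ v₂) (h : v₁ ^ 2 + v₂ ^ 2 ≤ u₁ ^ 2 + u₂ ^ 2) :
    v₁ = u₁ ∧ v₂ = u₂ := by
  have h3 := pow_le_pow_left₀ hu₁ h₁ 2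
  have h4 := pow_le_pow_left₀ hu₂ h₂ 2
  constructor
  · exact (pow_left_inj₀ (hu₁.trans h₁) hu₁ two_ne_zero).1 (by linarith)
  · exact (pow_left_inj₀ (hu₂.trans h₂) hu₂ two_ne_zero).1 (by linarith)

/-- The equality case of Minkowski's inequality for `a + b` with `|a| = t * d` and
`|b| = (1 - t) * d`. -/
lemma eq_mul_of_minkowski {a₁ a₂ b₁ b₂ d₁ d₂ d t : ℝ} (ht : t ∈ Set.Icc (0 : ℝ) 1)
    (hd₁ : 0 ≤ d₁) (hd₂ : 0 ≤ d₂)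
    (ha : a₁ ^ 2 + a₂ ^ 2 = (t * d) ^ 2) (hb : b₁ ^ 2 + b₂ ^ 2 = ((1 - t) * d) ^ 2)
    (hd : d ^ 2 = d₁ ^ 2 + d₂ ^ 2) (h₁ : d₁ ≤ a₁ + b₁) (h₂ : d₂ ≤ a₂ + b₂) :
    a₁ = t * d₁ ∧ a₂ = t * d₂ := by
  obtain ⟨ht0, ht1⟩ := ht
  have h3 := pow_le_pow_left₀ hd₁ h₁ 2
  have h4 := pow_le_pow_left₀ hd₂ h₂ 2
  have hinner : t * (1 - t) * d ^ 2 ≤ a₁ * b₁ + a₂ * b₂ := by nlinarith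
  -- The vectors `(1 - t) a` and `t b` have the same length and do not differ in direction.
  have hzero : ((1 - t) * a₁ - t * b₁) ^ 2 + ((1 - t) * a₂ - t * b₂) ^ 2 ≤ 0 := by
    have h5 := mul_le_mul_of_nonneg_left hinner (mul_nonneg ht0 (sub_nonneg.2 ht1))
    calc ((1 - t) * a₁ - t * b₁) ^ 2 + ((1 - t) * a₂ - t * b₂) ^ 2
        = (1 - t) ^ 2 * (a₁ ^ 2 + a₂ ^ 2) + t ^ 2 * (b₁ ^ 2 + b₂ ^ 2)
          - 2 * (t * (1 - t) * (a₁ * b₁ + a₂ * b₂)) := by ring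
      _ ≤ 0 := by rw [ha, hb]; linarith
  have e₁ : (1 - t) * a₁ - t * b₁ = 0 := by
    have : ((1 - t) * a₁ - t * b₁) ^ 2 = 0 := by
      linarith [sq_nonneg ((1 - t) * a₁ - t * b₁), sq_nonneg ((1 - t) * a₂ - t * b₂)]
    exact pow_eq_zero_iff two_ne_zero |>.1 this
  have e₂ : (1 - t) * a₂ - t * b₂ = 0 := by
    have : ((1 - t) * a₂ - t * b₂) ^ 2 = 0 := by
      linarith [sq_nonneg ((1 - t) * a₁ - t * b₁), sq_nonneg ((1 - t) * a₂ - t * b₂)]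
    exact pow_eq_zero_iff two_ne_zero |>.1 this
  refine eq_and_eq_of_le_of_sq_add_sq_le (mul_nonneg ht0 hd₁) (mul_nonneg ht0 hd₂) ?_ ?_ ?_
  · linarith [mul_le_mul_of_nonneg_left h₁ ht0]
  · linarith [mul_le_mul_of_nonneg_left h₂ ht0]
  · rw [ha, mul_pow, hd]
    linarith

lemma IsGeodSegment.comp_isometry {X Y : Type*} [MetricSpace X] [MetricSpace Y] {f : X → Y}
    (hf : Isometry f) {γ : ℝ → X} {x y : X} (hγ : IsGeodSegment γ x y) :
    IsGeodSegment (fun t => f (γ t)) (f x) (f y) where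
  source := by rw [hγ.source]
  target := by rw [hγ.target]
  dist_eq s hs t ht := by rw [hf.dist_eq, hf.dist_eq, hγ.dist_eq s hs t ht]

section Product

variable {Y₁ Y₂ : Type*} [MetricSpace Y₁] [MetricSpace Y₂]

lemma IsGeodSegment.dist_fst_snd {γ : ℝ → WithLp 2 (Y₁ × Y₂)} {p q : WithLp 2 (Y₁ × Y₂)}
    (hγ : IsGeodSegment γ p q) {t : ℝ} (ht : t ∈ Set.Icc (0 : ℝ) 1) :
    dist p.fst (γ t).fst = t * dist p.fst q.fst ∧
      dist p.snd (γ t).snd = t * dist p.snd q.snd := by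
  have h0 := hγ.dist_eq 0 (Set.left_mem_Icc.2 zero_le_one) t ht
  have h1 := hγ.dist_eq t ht 1 (Set.right_mem_Icc.2 zero_le_one)
  rw [hγ.source, zero_sub, abs_neg, abs_of_nonneg ht.1] at h0
  rw [hγ.target, abs_sub_comm, abs_of_nonneg (sub_nonneg.2 ht.2)] at h1
  refine eq_mul_of_minkowski ht dist_nonneg dist_nonneg ?_ ?_ (WithLp.prod_dist_sq_eq p q)
    (dist_triangle p.fst (γ t).fst q.fst) (dist_triangle p.snd (γ t).snd q.snd)
  · rw [← WithLp.prod_dist_sq_eq, h0]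
  · rw [← WithLp.prod_dist_sq_eq, h1]

lemma IsGeodSegment.fst_and_snd {γ : ℝ → WithLp 2 (Y₁ × Y₂)} {p q : WithLp 2 (Y₁ × Y₂)}
    (hγ : IsGeodSegment γ p q) :
    IsGeodSegment (fun t => (γ t).fst) p.fst q.fst ∧
      IsGeodSegment (fun t => (γ t).snd) p.snd q.snd := by
  have key : ∀ s ∈ Set.Icc (0 : ℝ) 1, ∀ t ∈ Set.Icc (0 : ℝ) 1,
      dist (γ s).fst (γ t).fst = |s - t| * dist p.fst q.fst ∧
      dist (γ s).snd (γ t).snd = |s - t| * dist p.snd q.snd := by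
    intro s hs t ht
    obtain ⟨hs₁, hs₂⟩ := hγ.dist_fst_snd hs
    obtain ⟨ht₁, ht₂⟩ := hγ.dist_fst_snd ht
    refine eq_and_eq_of_le_of_sq_add_sq_le (by positivity) (by positivity) ?_ ?_ ?_
    · rw [← abs_of_nonneg (dist_nonneg (x := p.fst) (y := q.fst)), ← abs_mul, sub_mul, ← hs₁,
        ← ht₁, dist_comm p.fst, dist_comm p.fst]
      exact abs_dist_sub_le _ _ _
    · rw [← abs_of_nonneg (dist_nonneg (x := p.snd) (y := q.snd)), ← abs_mul, sub_mul, ← hs₂,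
        ← ht₂, dist_comm p.snd, dist_comm p.snd]
      exact abs_dist_sub_le _ _ _
    · rw [← WithLp.prod_dist_sq_eq, hγ.dist_eq s hs t ht, mul_pow, WithLp.prod_dist_sq_eq]
      linarith
  exact ⟨⟨by rw [hγ.source], by rw [hγ.target], fun s hs t ht => (key s hs t ht).1⟩,
    ⟨by rw [hγ.source], by rw [hγ.target], fun s hs t ht => (key s hs t ht).2⟩⟩

lemma IsGeodSegment.prodMk {γ₁ : ℝ → Y₁} {γ₂ : ℝ → Y₂} {p q : WithLp 2 (Y₁ × Y₂)}
    (h₁ : IsGeodSegment γ₁ p.fst q.fst) (h₂ : IsGeodSegment γ₂ p.snd q.snd) :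
    IsGeodSegment (fun t => WithLp.toLp 2 (γ₁ t, γ₂ t)) p q where
  source := by rw [h₁.source, h₂.source]; rfl
  target := by rw [h₁.target, h₂.target]; rfl
  dist_eq s hs t ht := by
    rw [← pow_left_inj₀ dist_nonneg (by positivity) two_ne_zero, WithLp.prod_dist_sq_eq, mul_pow,
      WithLp.prod_dist_sq_eq p q]
    simp only [WithLp.toLp_fst, WithLp.toLp_snd]
    rw [h₁.dist_eq s hs t ht, h₂.dist_eq s hs t ht]
    ring

/-- The `ℓ²`-product of two CAT(0) spaces is CAT(0): the components of a geodesic are geodesics,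
and the CAT(0) inequality is affine in squared distances, which add up. -/
lemma IsCAT0.prod (hY₁ : IsCAT0 Y₁) (hY₂ : IsCAT0 Y₂) : IsCAT0 (WithLp 2 (Y₁ × Y₂)) where
  geodesic p q := by
    obtain ⟨γ₁, h₁⟩ := hY₁.geodesic p.fst q.fst
    obtain ⟨γ₂, h₂⟩ := hY₂.geodesic p.snd q.snd
    exact ⟨_, h₁.prodMk h₂⟩
  thin x y z γ η hγ hη x' y' z' hxy hxz hyz s hs t ht := by
    have h₁ := hY₁.dist_sq_le hγ.fst_and_snd.1 hη.fst_and_snd.1 hs ht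
    have h₂ := hY₂.dist_sq_le hγ.fst_and_snd.2 hη.fst_and_snd.2 hs ht
    rw [← pow_le_pow_iff_left₀ dist_nonneg dist_nonneg two_ne_zero, dist_sq_lineMap_lineMap, hxy,
      hxz, hyz, WithLp.prod_dist_sq_eq, WithLp.prod_dist_sq_eq x y, WithLp.prod_dist_sq_eq x z,
      WithLp.prod_dist_sq_eq y z]
    linarith

end Product

/-! ### Counting separated curtains in a product -/

section Count

variable {X : Type*} [MetricSpace X]

lemma Curtain.isChain_of_dual (hX : IsCAT0 X) {I : Set ℝ} (hI : IsClosed I)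
    (hI' : I.OrdConnected) {α : ℝ → X}
    (hα : ∀ s ∈ I, ∀ t ∈ I, dist (α s) (α t) = |s - t|) {n : ℕ}
    (hr : ∀ i : Fin n, Set.Icc ((2 * (i : ℕ) + 1 : ℝ) - 1 / 2) ((2 * (i : ℕ) + 1 : ℝ) + 1 / 2)
      ⊆ interior I) :
    IsChain fun i : Fin n => (⟨I, hI, hI', α, hα, 2 * (i : ℕ) + 1, hr i⟩ : Curtain X) := by
  constructor
  · intro i j hij
    rw [Set.disjoint_left]
    rintro x ⟨s, hs, hxs⟩ ⟨t, ht, hxt⟩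
    -- The projection to a geodesic does not depend on the point at which the curtain is dual.
    have hst : s = t := ((projectsTo_iff hX).1 hxs).symm.trans
      ((projectsTo_iff hX).1 (show ProjectsTo _ x t from hxt))
    subst hst
    simp only [Set.mem_Icc] at hs ht
    apply hij
    rcases lt_trichotomy (i : ℕ) (j : ℕ) with h | h | h
    · have : ((i : ℕ) : ℝ) + 1 ≤ (j : ℕ) := by exact_mod_cast h
      linarith
    · exact Fin.ext h
    · have : ((j : ℕ) : ℝ) + 1 ≤ (i : ℕ) := by exact_mod_cast h
      linarith
  · intro i j k hij hjk
    have hij' : ((i : ℕ) : ℝ) + 1 = (j : ℕ) := by exact_mod_cast hij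
    have hjk' : ((j : ℕ) : ℝ) + 1 = (k : ℕ) := by exact_mod_cast hjk
    refine Or.inl ⟨?_, ?_⟩
    · rintro x ⟨s, hs, hxs⟩
      simp only [Set.mem_Icc] at hs
      exact ⟨s, by simp only [Set.mem_Iio]; linarith, hxs⟩
    · rintro x ⟨s, hs, hxs⟩
      simp only [Set.mem_Icc] at hs
      exact ⟨s, by simp only [Set.mem_Ioi]; linarith, hxs⟩

/-- A geodesic that avoids a curtain has both ends on the same side of it. -/
lemma Curtain.Separates.of_segment_avoids (hX : IsCAT0 X) {h : Curtain X} {x z p q : X}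
    (hs : h.Separates {x} {z}) {σ : ℝ → X} (hσ : IsGeodSegment σ p q)
    (hav : ∀ u ∈ Set.Icc (0 : ℝ) 1, σ u ∉ h.carrier) :
    h.Separates {x} {p} ∨ h.Separates {z} {q} := by
  have hp : p ∉ h.carrier := by
    simpa [hσ.source] using hav 0 (Set.left_mem_Icc.2 zero_le_one)
  have hq : q ∉ h.carrier := by
    simpa [hσ.target] using hav 1 (Set.right_mem_Icc.2 zero_le_one)
  have hpq : ¬ h.Separates {p} {q} := by
    intro hpq
    obtain ⟨u, hu, hr⟩ := hpq.exists_proj_eq hX hσ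
    exact hav u hu ((mem_carrier_iff hX).2 ⟨by linarith, by linarith⟩)
  rw [separates_singleton_iff hX] at *
  rw [separates_singleton_iff hX]
  rw [mem_carrier_iff hX, Set.mem_Icc, not_and_or, not_le, not_le] at hp hq
  tauto

variable {Y₁ Y₂ : Type*} [MetricSpace Y₁] [MetricSpace Y₂]

/-- The key estimate. In the flat half-strip over `[x₁, y₁]` in the second direction, the
horizontal segments at heights `1, 3, …, 2L + 1` lie in the members of a chain of `L + 1`
curtains dual to the vertical side. By `L`-separation at most one curtain meets all of these
segments. Any other curtain misses the segment at some height `t`, so it crosses one of the two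
vertical sides below that height, and at most `t` curtains can do so on each side. -/
lemma card_le_of_separates_of_snd_eq (hX : IsCAT0 X) {f : WithLp 2 (Y₁ × Y₂) → X}
    (hf : Isometry f)
    (hgeo : ∀ p q : WithLp 2 (Y₁ × Y₂), ∃ γ : ℝ → WithLp 2 (Y₁ × Y₂), IsGeodSegment γ p q)
    (hY₂ : ¬ Bornology.IsBounded (Set.univ : Set Y₂)) {L : ℕ} {ι : Type*} {S : Finset ι}
    {c : ι → Curtain X}
    (hc : ∀ i ∈ S, ∀ j ∈ S, i ≠ j → Curtain.LSeparated L (c i) (c j))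
    {p q : WithLp 2 (Y₁ × Y₂)} (hpq : p.snd = q.snd)
    (hsep : ∀ i ∈ S, (c i).Separates {f p} {f q}) :
    S.card ≤ 2 * (L + 1) ^ 2 + 1 := by
  classical
  obtain ⟨w, hw⟩ : ∃ w : Y₂, (2 * L + 2 : ℝ) < dist w p.snd := by
    by_contra! hcon
    exact hY₂ ((Metric.isBounded_iff_subset_closedBall p.snd).2 ⟨_, fun w _ => hcon w⟩)
  set D := dist p.snd w with hD
  rw [dist_comm, ← hD] at hw
  have hD0 : 0 < D := by
    have : (0 : ℝ) ≤ L := L.cast_nonneg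
    linarith
  obtain ⟨v, hv⟩ := hgeo p (WithLp.toLp 2 (p.fst, w))
  obtain ⟨hv₁, hv₂⟩ := hv.fst_and_snd
  simp only [WithLp.toLp_fst, WithLp.toLp_snd] at hv₁ hv₂
  have hdiv : ∀ s ∈ Set.Icc (0 : ℝ) D, s / D ∈ Set.Icc (0 : ℝ) 1 := fun s hs =>
    ⟨div_nonneg hs.1 hD0.le, div_le_one_of_le₀ hs.2 hD0.le⟩
  -- `b` is a unit speed geodesic from the second coordinate of `p` to `w`, and the vertical
  -- geodesic in the product moves in the second coordinate only.
  set b : ℝ → Y₂ := fun s => (v (s / D)).snd with hb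
  have hb0 : b 0 = p.snd := by simp [hb, hv.source]
  have hbdist : ∀ s ∈ Set.Icc (0 : ℝ) D, ∀ t ∈ Set.Icc (0 : ℝ) D,
      dist (b s) (b t) = |s - t| := by
    intro s hs t ht
    rw [hb, hv₂.dist_eq _ (hdiv s hs) _ (hdiv t ht), ← hD, ← sub_div, abs_div, abs_of_pos hD0,
      div_mul_cancel₀ _ hD0.ne']
  set α : ℝ → X := fun s => f (WithLp.toLp 2 (p.fst, b s)) with hα
  have hαdist : ∀ s ∈ Set.Icc (0 : ℝ) D, ∀ t ∈ Set.Icc (0 : ℝ) D,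
      dist (α s) (α t) = |s - t| := by
    intro s hs t ht
    rw [hα, hf.dist_eq, WithLp.dist_toLp_same_fst]
    exact hbdist s hs t ht
  have hheight : ∀ i : Fin (L + 1), (2 * (i : ℕ) + 1 : ℝ) + 1 ≤ 2 * L + 2 := by
    intro i
    have : ((i : ℕ) : ℝ) ≤ L := by exact_mod_cast Nat.lt_succ_iff.1 i.2
    linarith
  have hr : ∀ i : Fin (L + 1),
      Set.Icc ((2 * (i : ℕ) + 1 : ℝ) - 1 / 2) ((2 * (i : ℕ) + 1 : ℝ) + 1 / 2)
        ⊆ interior (Set.Icc 0 D) := by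
    intro i t ht
    have hi : (0 : ℝ) ≤ (i : ℕ) := Nat.cast_nonneg _
    rw [interior_Icc]
    exact ⟨by linarith [ht.1], by linarith [ht.2, hheight i]⟩
  have hmem : ∀ i : Fin (L + 1), (2 * (i : ℕ) + 1 : ℝ) ∈ Set.Icc (0 : ℝ) D := fun i =>
    interior_subset (hr i ⟨by linarith, by linarith⟩)
  have hchain := Curtain.isChain_of_dual hX isClosed_Icc Set.ordConnected_Icc hαdist hr
  -- `σ i` is the horizontal segment at height `2 i + 1`; its points project to its left end.
  choose σ hσ using fun i : Fin (L + 1) => hgeo (WithLp.toLp 2 (p.fst, b (2 * (i : ℕ) + 1)))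
    (WithLp.toLp 2 (q.fst, b (2 * (i : ℕ) + 1)))
  have hσX := fun i => (hσ i).comp_isometry hf
  have hσsnd : ∀ i, ∀ u ∈ Set.Icc (0 : ℝ) 1, (σ i u).snd = b (2 * (i : ℕ) + 1) := by
    intro i u hu
    have := ((hσ i).dist_fst_snd hu).2
    simp only [WithLp.toLp_snd, dist_self, mul_zero] at this
    exact (dist_eq_zero.1 this).symm
  have hσcarrier : ∀ i : Fin (L + 1), ∀ u ∈ Set.Icc (0 : ℝ) 1, f (σ i u) ∈
      (⟨Set.Icc 0 D, isClosed_Icc, Set.ordConnected_Icc, α, hαdist, 2 * (i : ℕ) + 1, hr i⟩ :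
        Curtain X).carrier := by
    intro i u hu
    refine ⟨2 * (i : ℕ) + 1, ⟨by simp, by simp⟩, hmem i, fun s _ => ?_⟩
    simp only [hα]
    rw [hf.dist_eq, hf.dist_eq, ← pow_le_pow_iff_left₀ dist_nonneg dist_nonneg two_ne_zero,
      WithLp.prod_dist_sq_eq, WithLp.prod_dist_sq_eq]
    simp only [WithLp.toLp_fst, WithLp.toLp_snd, hσsnd i u hu, dist_self]
    have := sq_nonneg (dist (b (2 * (i : ℕ) + 1)) (b s))
    linarith
  set full := S.filter fun j => ∀ i, ∃ u ∈ Set.Icc (0 : ℝ) 1, f (σ i u) ∈ (c j).carrier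
    with hfull
  set left : Fin (L + 1) → Finset ι := fun i =>
    S.filter fun j => (c j).Separates {f p} {α (2 * (i : ℕ) + 1)} with hleft
  set right : Fin (L + 1) → Finset ι := fun i =>
    S.filter fun j => (c j).Separates {f q} {f (WithLp.toLp 2 (q.fst, b (2 * (i : ℕ) + 1)))}
    with hright
  have hcover : S ⊆ full ∪ Finset.univ.biUnion fun i => left i ∪ right i := by
    intro j hj
    rw [Finset.mem_union, or_iff_not_imp_left]
    intro hjf
    have : ∃ i, ∀ u ∈ Set.Icc (0 : ℝ) 1, f (σ i u) ∉ (c j).carrier := by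
      by_contra! hcon
      exact hjf (Finset.mem_filter.2 ⟨hj, hcon⟩)
    obtain ⟨i, hi⟩ := this
    simp only [Finset.mem_biUnion, Finset.mem_univ, true_and, Finset.mem_union]
    refine ⟨i, ?_⟩
    rcases (hsep j hj).of_segment_avoids hX (hσX i) hi with h | h
    · exact Or.inl (Finset.mem_filter.2 ⟨hj, h⟩)
    · exact Or.inr (Finset.mem_filter.2 ⟨hj, h⟩)
  have hfullcard : full.card ≤ 1 := by
    rw [Finset.card_le_one]
    intro j hj k hk
    by_contra hjk
    obtain ⟨hjS, hj⟩ := Finset.mem_filter.1 hj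
    obtain ⟨hkS, hk⟩ := Finset.mem_filter.1 hk
    have := (hc j hjS k hkS hjk).2 (L + 1) _ hchain fun i => by
      obtain ⟨u, hu, hu'⟩ := hj i
      obtain ⟨u₂, hu₂, hu₂'⟩ := hk i
      exact ⟨⟨_, hσcarrier i u hu, hu'⟩, ⟨_, hσcarrier i u₂ hu₂, hu₂'⟩⟩
    omega
  have hdisj : ∀ j ∈ S, ∀ k ∈ S, j ≠ k → Disjoint (c j).carrier (c k).carrier :=
    fun j hj k hk hjk => (hc j hj k hk hjk).1
  have hzero : (0 : ℝ) ∈ Set.Icc (0 : ℝ) D := ⟨le_rfl, hD0.le⟩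
  have hleftcard : ∀ i, (left i).card ≤ 2 * (i : ℕ) + 1 := by
    intro i
    refine Curtain.card_le_of_separates hX (c := c) (x := f p) (y := α (2 * (i : ℕ) + 1))
      (fun j hj k hk => hdisj j (Finset.mem_filter.1 hj).1 k (Finset.mem_filter.1 hk).1) ?_
      fun j hj => (Finset.mem_filter.1 hj).2
    rw [hα, hf.dist_eq]
    change dist (WithLp.toLp 2 (p.fst, p.snd)) _ ≤ _
    rw [WithLp.dist_toLp_same_fst, ← hb0, hbdist 0 hzero _ (hmem i), zero_sub, abs_neg, abs_of_nonneg (hmem i).1]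
    push_cast
    exact le_rfl
  have hrightcard : ∀ i, (right i).card ≤ 2 * (i : ℕ) + 1 := by
    intro i
    refine Curtain.card_le_of_separates hX (c := c) (x := f q)
      (y := f (WithLp.toLp 2 (q.fst, b (2 * (i : ℕ) + 1))))
      (fun j hj k hk => hdisj j (Finset.mem_filter.1 hj).1 k (Finset.mem_filter.1 hk).1) ?_
      fun j hj => (Finset.mem_filter.1 hj).2
    rw [hf.dist_eq]
    change dist (WithLp.toLp 2 (q.fst, q.snd)) _ ≤ _
    rw [WithLp.dist_toLp_same_fst, ← hpq, ← hb0, hbdist 0 hzero _ (hmem i), zero_sub, abs_neg, abs_of_nonneg (hmem i).1]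
    push_cast
    exact le_rfl
  have hsum : ∀ n : ℕ, ∑ i : Fin n, 2 * (2 * (i : ℕ) + 1) = 2 * n ^ 2 := by
    intro n
    induction n with
    | zero => simp
    | succ n ih =>
      rw [Fin.sum_univ_castSucc]
      simp only [Fin.val_castSucc, Fin.val_last, ih]
      ring
  calc S.card ≤ full.card + (Finset.univ.biUnion fun i => left i ∪ right i).card :=
        (Finset.card_le_card hcover).trans (Finset.card_union_le _ _)
    _ ≤ 1 + ∑ i : Fin (L + 1), 2 * (2 * (i : ℕ) + 1) := by
        refine add_le_add hfullcard (Finset.card_biUnion_le.trans (Finset.sum_le_sum ?_))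
        intro i _
        have := Finset.card_union_le (left i) (right i)
        have := hleftcard i
        have := hrightcard i
        omega
    _ = 2 * (L + 1) ^ 2 + 1 := by rw [hsum, add_comm]

/-- The corner `(y₁, x₂)` reduces the case of two arbitrary points `(x₁, x₂)`, `(y₁, y₂)` to
pairs of points that differ in one coordinate. -/
lemma card_le_of_separates_of_prod (hX : IsCAT0 X) {f : WithLp 2 (Y₁ × Y₂) → X}
    (hf : Isometry f)
    (hgeo : ∀ p q : WithLp 2 (Y₁ × Y₂), ∃ γ : ℝ → WithLp 2 (Y₁ × Y₂), IsGeodSegment γ p q)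
    (hY₁ : ¬ Bornology.IsBounded (Set.univ : Set Y₁))
    (hY₂ : ¬ Bornology.IsBounded (Set.univ : Set Y₂)) {L : ℕ} {ι : Type*} {S : Finset ι}
    {c : ι → Curtain X}
    (hc : ∀ i ∈ S, ∀ j ∈ S, i ≠ j → Curtain.LSeparated L (c i) (c j))
    {p q : WithLp 2 (Y₁ × Y₂)} (hsep : ∀ i ∈ S, (c i).Separates {f p} {f q}) :
    S.card ≤ 4 * (L + 1) ^ 2 + 3 := by
  classical
  let m : WithLp 2 (Y₁ × Y₂) := WithLp.toLp 2 (q.fst, p.snd)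
  set A := S.filter fun i => f m ∈ (c i).carrier with hA
  set B := S.filter fun i => (c i).Separates {f p} {f m} with hB
  set C := S.filter fun i => (c i).Separates {f m} {f q} with hC
  have hcover : S ⊆ A ∪ (B ∪ C) := by
    intro i hi
    simp only [hA, hB, hC, Finset.mem_union, Finset.mem_filter, hi, true_and]
    exact (hsep i hi).trichotomy hX (f m)
  have hAcard : A.card ≤ 1 := by
    rw [Finset.card_le_one]
    intro i hi j hj
    by_contra hij
    obtain ⟨hiS, hi⟩ := Finset.mem_filter.1 hi
    obtain ⟨hjS, hj⟩ := Finset.mem_filter.1 hj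
    exact Set.disjoint_left.1 (hc i hiS j hjS hij).1 hi hj
  have hBcard : B.card ≤ 2 * (L + 1) ^ 2 + 1 :=
    card_le_of_separates_of_snd_eq hX hf hgeo hY₂
      (fun i hi j hj => hc i (Finset.mem_filter.1 hi).1 j (Finset.mem_filter.1 hj).1)
      (p := p) (q := m) rfl fun i hi => (Finset.mem_filter.1 hi).2
  have hCcard : C.card ≤ 2 * (L + 1) ^ 2 + 1 := by
    let e : WithLp 2 (Y₂ × Y₁) ≃ᵢ WithLp 2 (Y₁ × Y₂) := IsometryEquiv.withLpProdComm 2 Y₂ Y₁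
    refine card_le_of_separates_of_snd_eq hX (f := fun a => f (e a)) (hf.comp e.isometry)
      (fun a b => ?_) hY₁
      (fun i hi j hj => hc i (Finset.mem_filter.1 hi).1 j (Finset.mem_filter.1 hj).1)
      (p := e.symm m) (q := e.symm q) rfl fun i hi => ?_
    · obtain ⟨γ, hγ⟩ := hgeo (e a) (e b)
      exact ⟨_, by simpa using hγ.comp_isometry e.symm.isometry⟩
    · simpa using (Finset.mem_filter.1 hi).2
  have := (Finset.card_le_card hcover).trans (Finset.card_union_le _ _)
  have := Finset.card_union_le B C
  omega

end Count

/-! ### Summation over `L` -/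

lemma IsCurtainWeight.isBounded_of_curtainDistL_le {X : Type*} [MetricSpace X] {lam : ℕ+ → ℝ}
    (hlam : IsCurtainWeight lam) {S : Set X} (K : ℕ)
    (h : ∀ (L : ℕ+), ∀ x ∈ S, ∀ y ∈ S, curtainDistL L x y ≤ (K * (L : ℕ) ^ 2 : ℕ)) :
    IsBoundedInCurtainModel lam S := by
  have hnn : ∀ L : ℕ+, 0 ≤ (K : ℝ) * (((L : ℕ) : ℝ) ^ 2 * lam L) := fun L =>
    mul_nonneg K.cast_nonneg (mul_nonneg (by positivity) (hlam.mem_Ioo L).1.le)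
  refine ⟨(∑' L : ℕ+, (K : ℝ) * (((L : ℕ) : ℝ) ^ 2 * lam L)).toNNReal, fun x hx y hy => ?_⟩
  change _ ≤ ENNReal.ofReal _
  rw [ENNReal.ofReal_tsum_of_nonneg hnn (hlam.summable_sq.mul_left _)]
  refine ENNReal.tsum_le_tsum fun L => ?_
  have h1 : (curtainDistL (L : ℕ) x y : ℝ≥0∞) ≤ ((K * (L : ℕ) ^ 2 : ℕ) : ℝ≥0∞) := by
    exact_mod_cast ENat.toENNReal_le.2 (h L x hx y hy)
  calc ENNReal.ofReal (lam L) * (curtainDistL (L : ℕ) x y : ℝ≥0∞)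
      ≤ ENNReal.ofReal (lam L) * ((K * (L : ℕ) ^ 2 : ℕ) : ℝ≥0∞) := by gcongr
    _ = ENNReal.ofReal ((K : ℝ) * (((L : ℕ) : ℝ) ^ 2 * lam L)) := by
        rw [← ENNReal.ofReal_natCast, ← ENNReal.ofReal_mul (hlam.mem_Ioo L).1.le]
        push_cast
        ring_nf

lemma IsCurtainWeight.isBounded_range {lam : ℕ+ → ℝ} (hlam : IsCurtainWeight lam)
    {X Y₁ Y₂ : Type*} [MetricSpace X] [MetricSpace Y₁] [MetricSpace Y₂] (hX : IsCAT0 X)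
    {f : WithLp 2 (Y₁ × Y₂) → X} (hf : Isometry f)
    (hgeo : ∀ p q : WithLp 2 (Y₁ × Y₂), ∃ γ : ℝ → WithLp 2 (Y₁ × Y₂), IsGeodSegment γ p q)
    (hY₁ : ¬ Bornology.IsBounded (Set.univ : Set Y₁))
    (hY₂ : ¬ Bornology.IsBounded (Set.univ : Set Y₂)) :
    IsBoundedInCurtainModel lam (Set.range f) := by
  refine hlam.isBounded_of_curtainDistL_le 20 ?_
  rintro L _ ⟨p, rfl⟩ _ ⟨q, rfl⟩
  unfold curtainDistL
  split_ifs with hpq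
  · exact zero_le
  have hL : 1 ≤ (L : ℕ) := L.pos
  calc (1 : ℕ∞) + sSup _ ≤ 1 + ((4 * ((L : ℕ) + 1) ^ 2 + 3 : ℕ) : ℕ∞) := by
        gcongr
        refine sSup_le ?_
        rintro _ ⟨n, c, rfl, hc, hsep⟩
        have := card_le_of_separates_of_prod hX hf hgeo hY₁ hY₂ (S := Finset.univ) (c := c)
          (fun i _ j _ => hc.2 i j) (fun i _ => hsep i)
        rw [Finset.card_univ, Fintype.card_fin] at this
        exact_mod_cast this
    _ ≤ ((20 * (L : ℕ) ^ 2 : ℕ) : ℕ∞) := by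
        have : 1 + (4 * ((L : ℕ) + 1) ^ 2 + 3) ≤ 20 * (L : ℕ) ^ 2 := by nlinarith
        exact_mod_cast this

theorem mainTheorem10 (lam : ℕ+ → ℝ) (hlam : IsCurtainWeight lam) :
    (∀ (X : Type*) [MetricSpace X] (Y₁ : Type*) [MetricSpace Y₁] (Y₂ : Type*) [MetricSpace Y₂]
        (Z : Set X) (_e : WithLp 2 (Y₁ × Y₂) ≃ᵢ Z),
        IsCAT0 X → IsClosed Z → IsGeodConvex Z →
        ¬ Bornology.IsBounded (Set.univ : Set Y₁) →
        ¬ Bornology.IsBounded (Set.univ : Set Y₂) →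
        IsBoundedInCurtainModel lam Z) ∧
    (∀ (X : Type*) [MetricSpace X] (Y : Type*) [MetricSpace Y],
        IsCAT0 X → IsCAT0 Y →
        ¬ Bornology.IsBounded (Set.univ : Set X) →
        ¬ Bornology.IsBounded (Set.univ : Set Y) →
        IsCAT0 (WithLp 2 (X × Y)) ∧
        IsBoundedInCurtainModel lam (Set.univ : Set (WithLp 2 (X × Y)))) := by
  refine ⟨?_, ?_⟩
  · intro X _ Y₁ _ Y₂ _ Z e hX _ hZ hY₁ hY₂
    have hf : Isometry fun p => (e p : X) := isometry_subtype_coe.comp e.isometry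
    have hrange : Set.range (fun p => (e p : X)) = Z := by
      ext x
      exact ⟨by rintro ⟨p, rfl⟩; exact (e p).2, fun hx => ⟨e.symm ⟨x, hx⟩, by simp⟩⟩
    rw [← hrange]
    refine hlam.isBounded_range hX hf (fun p q => ?_) hY₁ hY₂
    obtain ⟨γ, hγ⟩ := hX.geodesic (e p : X) (e q : X)
    have hmem := hZ _ (e p).2 _ (e q).2 γ hγ
    have hex : ∀ t : ℝ, ∃ w, t ∈ Set.Icc (0 : ℝ) 1 → (e w : X) = γ t := by
      intro t
      by_cases ht : t ∈ Set.Icc (0 : ℝ) 1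
      · exact ⟨e.symm ⟨γ t, hmem t ht⟩, fun _ => by simp⟩
      · exact ⟨p, fun h => absurd h ht⟩
    choose η hη using hex
    refine ⟨η, hf.injective ?_, hf.injective ?_, fun s hs t ht => ?_⟩
    · rw [hη 0 (Set.left_mem_Icc.2 zero_le_one), hγ.source]
    · rw [hη 1 (Set.right_mem_Icc.2 zero_le_one), hγ.target]
    · rw [← hf.dist_eq, ← hf.dist_eq p q, hη s hs, hη t ht, hγ.dist_eq s hs t ht]
  · intro X _ Y _ hX hY hXu hYu
    have hprod := hX.prod hY
    refine ⟨hprod, ?_⟩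
    have := hlam.isBounded_range hprod isometry_id hprod.geodesic hXu hYu
    rwa [Set.range_id] at this
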